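/- Let $d\ge 1$. For $f\in C_c(\mathbb R^d)$ (complex-valued, continuous, compactly supported) write $f$ also for the operator of multiplication by $f$ on $L^2(\mathbb R^d)$. An operator $T\in\mathcal B(L^2(\mathbb R^d))$ is \emph{locally compact} if $Tf$ and $fT$ are compact for all $f\in C_c(\mathbb R^d)$, and has \emph{propagation} $R$ if $fTg=0$ for all $f,g\in C_c(\mathbb R^d)$ with $\inf\{\|x-y\| : x\in\operatorname{supp} f,\ y\in\operatorname{supp} g\}>R$. It has finite propagation if it has propagation $R$ for some $R>0$. Let $\mathbb C[\mathbb R^d]$ be the $*$-algebra of locally compact operators of finite propagation, and let the Roe algebra $C^*(\mathbb R^d)$ be its norm closure in $\mathcal B(L^2(\mathbb R^d))$. For a C*-algebra $A$ with unitization $A^+=\mathbb C\oplus A$, $K_0(A)$ denotes the kernel of the map $K_0(A^+)\to K_0(\mathbb C)$ induced by $(z,a)\mapsto z$, where for a unital C*-algebra $K_0$ is the Grothendieck group of the monoid of Murray--von Neumann classes of projections in matrix algebras under direct sum; a projection $p\in A$ has a class $[p]\in K_0(A)$. Let $r>0$ and let $\mathfrak D\subseteq\mathbb R^d$ be $r$-uniformly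 discrete, i.e. the open balls $B_r(\gamma)$, $\gamma\in\mathfrak D$, are mutually disjoint. Let $\mathcal H$ be a closed subspace of $L^2(\mathbb R^d)$ with an orthonormal basis $\{\phi_\gamma\}_{\gamma\in\mathfrak D}$ such that $\operatorname{supp}\phi_\gamma\subseteq B_r(\gamma)$ for all $\gamma\in\mathfrak D$ (essential support). Let $P_{\mathcal H}$ be the orthogonal projection onto $\mathcal H$. Then $P_{\mathcal H}=\sum_{\gamma\in\mathfrak D}|\phi_\gamma\rangle\langle\phi_\gamma|$ (strongly convergent sum), and: (i) $P_{\mathcal H}$ is locally compact and has propagation $2r$; in particular $P_{\mathcal H}\in\mathbb C[\mathbb R^d]$. (ii) $P_{\mathcal H}\in C^*(\mathbb R^d)$ and $[P_{\mathcal H}]=0$ in $K_0(C^*(\mathbb R^d))$. -/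

import Mathlib

noncomputable section

open scoped Matrix

namespace KTheory

universe u v

section Projections

variable {R : Type u} [Ring R] [StarRing R]

/-- Murray-von Neumann equivalence of square matrices, possibly of different sizes, over a
`*`-ring: `p = v v*` and `q = v* v` for some rectangular matrix `v`. -/
def MvNEquiv {m n : Type*} [Fintype m] [Fintype n]
    (p : Matrix m m R) (q : Matrix n n R) : Prop :=
  ∃ v : Matrix m n R, p = v * vᴴ ∧ q = vᴴ * v

section Lemmas

variable {l m n k : Type*} [Fintype l] [Fintype m] [Fintype n] [Fintype k]

theorem MvNEquiv.refl {p : Matrix m m R} (hp : IsStarProjection p) : MvNEquiv p p := by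
  have h1 : pᴴ = p := hp.isSelfAdjoint
  have h2 : p * p = p := hp.isIdempotentElem
  exact ⟨p, by rw [h1, h2], by rw [h1, h2]⟩

theorem MvNEquiv.symm {p : Matrix m m R} {q : Matrix n n R} (h : MvNEquiv p q) :
    MvNEquiv q p := by
  obtain ⟨v, h1, h2⟩ := h
  exact ⟨vᴴ, by rw [Matrix.conjTranspose_conjTranspose, h2],
    by rw [Matrix.conjTranspose_conjTranspose, h1]⟩

theorem MvNEquiv.trans {p : Matrix l l R} {q : Matrix m m R} {r : Matrix n n R}
    (hp : IsStarProjection p) (hr : IsStarProjection r)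
    (h : MvNEquiv p q) (h' : MvNEquiv q r) : MvNEquiv p r := by
  obtain ⟨v, h1, h2⟩ := h
  obtain ⟨w, h3, h4⟩ := h'
  have hp2 : p * p = p := hp.isIdempotentElem
  have hr2 : r * r = r := hr.isIdempotentElem
  refine ⟨v * w, ?_, ?_⟩
  · calc p = p * p := hp2.symm
      _ = v * (vᴴ * v) * vᴴ := by simp only [h1, Matrix.mul_assoc]
      _ = v * (w * wᴴ) * vᴴ := by rw [← h2, h3]
      _ = v * w * (v * w)ᴴ := by simp only [Matrix.conjTranspose_mul, Matrix.mul_assoc]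
  · calc r = r * r := hr2.symm
      _ = wᴴ * (w * wᴴ) * w := by simp only [h4, Matrix.mul_assoc]
      _ = wᴴ * (vᴴ * v) * w := by rw [← h3, h2]
      _ = (v * w)ᴴ * (v * w) := by simp only [Matrix.conjTranspose_mul, Matrix.mul_assoc]

theorem MvNEquiv.reindex (e : m ≃ n) {p : Matrix m m R} (hp : IsStarProjection p) :
    MvNEquiv p (Matrix.reindex e e p) := by
  have h1 : pᴴ = p := hp.isSelfAdjoint
  have h2 : p * p = p := hp.isIdempotentElem
  refine ⟨p.submatrix id e.symm, ?_, ?_⟩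
  · rw [Matrix.conjTranspose_submatrix, Matrix.submatrix_mul_equiv, h1, h2, Matrix.submatrix_id_id]
  · rw [Matrix.conjTranspose_submatrix, h1, Matrix.reindex_apply,
      ← Matrix.submatrix_mul p p e.symm id e.symm Function.bijective_id, h2]

theorem MvNEquiv.fromBlocks {p : Matrix l l R} {p' : Matrix m m R} {q : Matrix n n R}
    {q' : Matrix k k R} (h : MvNEquiv p p') (h' : MvNEquiv q q') :
    MvNEquiv (Matrix.fromBlocks p 0 0 q) (Matrix.fromBlocks p' 0 0 q') := by
  obtain ⟨v, h1, h2⟩ := h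
  obtain ⟨w, h3, h4⟩ := h'
  refine ⟨Matrix.fromBlocks v 0 0 w, ?_, ?_⟩
  · simp [Matrix.fromBlocks_conjTranspose, Matrix.fromBlocks_multiply, ← h1, ← h3]
  · simp [Matrix.fromBlocks_conjTranspose, Matrix.fromBlocks_multiply, ← h2, ← h4]

theorem isStarProjection_fromBlocks {p : Matrix m m R} {q : Matrix n n R}
    (hp : IsStarProjection p) (hq : IsStarProjection q) :
    IsStarProjection (Matrix.fromBlocks p 0 0 q) := by
  have h1 : pᴴ = p := hp.isSelfAdjoint
  have h2 : p * p = p := hp.isIdempotentElem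
  have h3 : qᴴ = q := hq.isSelfAdjoint
  have h4 : q * q = q := hq.isIdempotentElem
  constructor
  · simp [IsIdempotentElem, Matrix.fromBlocks_multiply, h2, h4]
  · simp [isSelfAdjoint_iff, Matrix.star_eq_conjTranspose, Matrix.fromBlocks_conjTranspose, h1, h3]

theorem isStarProjection_reindex (e : m ≃ n) {p : Matrix m m R} (hp : IsStarProjection p) :
    IsStarProjection (Matrix.reindex e e p) := by
  have h1 : pᴴ = p := hp.isSelfAdjoint
  have h2 : p * p = p := hp.isIdempotentElem
  constructor
  · simp only [IsIdempotentElem, Matrix.reindex_apply]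
    rw [Matrix.submatrix_mul_equiv, h2]
  · rw [isSelfAdjoint_iff, Matrix.star_eq_conjTranspose, Matrix.reindex_apply,
      Matrix.conjTranspose_submatrix, h1]

end Lemmas

variable (R) in
/-- A projection in some matrix algebra `M_n(R)`. -/
structure MatProj : Type u where
  size : ℕ
  mat : Matrix (Fin size) (Fin size) R
  isStarProjection : IsStarProjection mat

variable (R) in
/-- Murray-von Neumann equivalence of projections in `⋃ₙ M_n(R)`. -/
instance MatProj.setoid : Setoid (MatProj R) where
  r p q := MvNEquiv p.mat q.mat
  iseqv :=
    { refl := fun p => MvNEquiv.refl p.isStarProjection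
      symm := fun h => h.symm
      trans := fun {p _ r} h h' => h.trans p.isStarProjection r.isStarProjection h' }

/-- The orthogonal direct sum `diag(p, q)`. -/
def MatProj.directSum (p q : MatProj R) : MatProj R where
  size := p.size + q.size
  mat := Matrix.reindex finSumFinEquiv finSumFinEquiv (Matrix.fromBlocks p.mat 0 0 q.mat)
  isStarProjection := isStarProjection_reindex _
    (isStarProjection_fromBlocks p.isStarProjection q.isStarProjection)

variable (R) in
/-- The zero projection (of size `0`; it is equivalent to the zero projection of any size). -/
def MatProj.zero : MatProj R where
  size := 0
  mat := 0
  isStarProjection := .zero _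

theorem MatProj.directSum_equiv (p q : MatProj R) :
    MvNEquiv (p.directSum q).mat (Matrix.fromBlocks p.mat 0 0 q.mat) :=
  (MvNEquiv.reindex _
    (isStarProjection_fromBlocks p.isStarProjection q.isStarProjection)).symm

variable (R) in
/-- The set `V(R)` of Murray-von Neumann classes of projections in matrix algebras over `R`. -/
def ProjMonoid : Type u := Quotient (MatProj.setoid R)

/-- The class of a projection in `V(R)`. -/
def ProjMonoid.mk (p : MatProj R) : ProjMonoid R := Quotient.mk _ p

/-- The addition of `V(R)` is induced by the orthogonal direct sum. -/
instance ProjMonoid.instAdd : Add (ProjMonoid R) where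
  add := Quotient.map₂ MatProj.directSum (by
    intro p p' h q q' h'
    have hp := isStarProjection_fromBlocks p.isStarProjection q.isStarProjection
    have hp' := isStarProjection_fromBlocks p'.isStarProjection q'.isStarProjection
    exact ((MatProj.directSum_equiv p q).trans (p.directSum q).isStarProjection hp'
      (MvNEquiv.fromBlocks h h')).trans (p.directSum q).isStarProjection
      (p'.directSum q').isStarProjection (MatProj.directSum_equiv p' q').symm)

instance ProjMonoid.instZero : Zero (ProjMonoid R) where
  zero := ProjMonoid.mk (MatProj.zero R)

theorem ProjMonoid.add_comm' (a b : ProjMonoid R) : a + b = b + a := by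
  refine Quotient.inductionOn₂ a b fun p q => Quotient.sound ?_
  have hp := p.isStarProjection
  have hq := q.isStarProjection
  have h1 : p.matᴴ = p.mat := hp.isSelfAdjoint
  have h2 : p.mat * p.mat = p.mat := hp.isIdempotentElem
  have h3 : q.matᴴ = q.mat := hq.isSelfAdjoint
  have h4 : q.mat * q.mat = q.mat := hq.isIdempotentElem
  have key : MvNEquiv (Matrix.fromBlocks p.mat 0 0 q.mat) (Matrix.fromBlocks q.mat 0 0 p.mat) := by
    refine ⟨Matrix.fromBlocks 0 p.mat q.mat 0, ?_, ?_⟩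
    · simp [Matrix.fromBlocks_conjTranspose, Matrix.fromBlocks_multiply, h1, h2, h3, h4]
    · simp [Matrix.fromBlocks_conjTranspose, Matrix.fromBlocks_multiply, h1, h2, h3, h4]
  exact ((MatProj.directSum_equiv p q).trans (p.directSum q).isStarProjection
    (isStarProjection_fromBlocks hq hp) key).trans (p.directSum q).isStarProjection
    (q.directSum p).isStarProjection (MatProj.directSum_equiv q p).symm

theorem ProjMonoid.add_assoc' (a b c : ProjMonoid R) : a + b + c = a + (b + c) := by
  refine Quotient.inductionOn₃ a b c fun p q r => Quotient.sound ?_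
  have hp := p.isStarProjection
  have hq := q.isStarProjection
  have hr := r.isStarProjection
  have h1 : MvNEquiv ((p.directSum q).directSum r).mat
      (Matrix.fromBlocks (Matrix.fromBlocks p.mat 0 0 q.mat) 0 0 r.mat) :=
    (MatProj.directSum_equiv _ _).trans ((p.directSum q).directSum r).isStarProjection
      (isStarProjection_fromBlocks (isStarProjection_fromBlocks hp hq) hr)
      (MvNEquiv.fromBlocks (MatProj.directSum_equiv p q) (MvNEquiv.refl hr))
  have h2 : MvNEquiv (p.directSum (q.directSum r)).mat
      (Matrix.fromBlocks p.mat 0 0 (Matrix.fromBlocks q.mat 0 0 r.mat)) :=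
    (MatProj.directSum_equiv _ _).trans (p.directSum (q.directSum r)).isStarProjection
      (isStarProjection_fromBlocks hp (isStarProjection_fromBlocks hq hr))
      (MvNEquiv.fromBlocks (MvNEquiv.refl hp) (MatProj.directSum_equiv q r))
  have h3 : MvNEquiv (Matrix.fromBlocks (Matrix.fromBlocks p.mat 0 0 q.mat) 0 0 r.mat)
      (Matrix.fromBlocks p.mat 0 0 (Matrix.fromBlocks q.mat 0 0 r.mat)) := by
    have := MvNEquiv.reindex (Equiv.sumAssoc (Fin p.size) (Fin q.size) (Fin r.size))
      (isStarProjection_fromBlocks (isStarProjection_fromBlocks hp hq) hr)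
    convert this using 1
    ext i j
    rcases i with i | i | i <;> rcases j with j | j | j <;> rfl
  exact (h1.trans ((p.directSum q).directSum r).isStarProjection
    (isStarProjection_fromBlocks hp (isStarProjection_fromBlocks hq hr)) h3).trans
    ((p.directSum q).directSum r).isStarProjection (p.directSum (q.directSum r)).isStarProjection
    h2.symm

theorem ProjMonoid.zero_add' (a : ProjMonoid R) : 0 + a = a := by
  refine Quotient.inductionOn a fun p => Quotient.sound ?_
  have hp := p.isStarProjection
  have h1 : p.matᴴ = p.mat := hp.isSelfAdjoint
  have h2 : p.mat * p.mat = p.mat := hp.isIdempotentElem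
  have key : MvNEquiv (Matrix.fromBlocks (MatProj.zero R).mat 0 0 p.mat) p.mat := by
    refine ⟨Matrix.fromRows 0 p.mat, ?_, ?_⟩
    · ext i j
      rcases i with i | i
      · exact i.elim0
      · rcases j with j | j
        · exact j.elim0
        · simp [Matrix.conjTranspose_fromRows_eq_fromCols_conjTranspose, h1, h2]
    · simp [Matrix.conjTranspose_fromRows_eq_fromCols_conjTranspose, h1, h2,
        Matrix.fromCols_mul_fromRows]
  exact (MatProj.directSum_equiv _ p).trans ((MatProj.zero R).directSum p).isStarProjection hp key

instance ProjMonoid.instAddCommMonoid : AddCommMonoid (ProjMonoid R) where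
  add_assoc := ProjMonoid.add_assoc'
  zero_add := ProjMonoid.zero_add'
  add_zero a := by rw [ProjMonoid.add_comm', ProjMonoid.zero_add']
  add_comm := ProjMonoid.add_comm'
  nsmul := nsmulRec

variable (R) in
/-- The group `K₀₀(R)`, the Grothendieck group of `V(R)`. For a unital C*-algebra it is `K₀(R)`. -/
abbrev K00 : Type u := Algebra.GrothendieckAddGroup (ProjMonoid R)

/-- The canonical homomorphism `V(R) → K₀₀(R)`. -/
def K00.of : ProjMonoid R →+ K00 R := Algebra.GrothendieckAddGroup.of

end Projections

section Functoriality

variable {A : Type u} {B : Type v} [Ring A] [StarRing A] [Algebra ℂ A] [Ring B] [StarRing B]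
  [Algebra ℂ B]

theorem conjTranspose_map (φ : A →⋆ₐ[ℂ] B) {m n : Type*} (p : Matrix m n A) :
    (p.map φ)ᴴ = pᴴ.map φ := by
  ext i j
  simp [map_star]

theorem map_mul' (φ : A →⋆ₐ[ℂ] B) {l m n : Type*} [Fintype m] (p : Matrix l m A)
    (q : Matrix m n A) : (p * q).map φ = p.map φ * q.map φ := by
  ext i j
  simp [Matrix.mul_apply]

/-- Entrywise application of a unital `*`-homomorphism to a projection. -/
def MatProj.map (φ : A →⋆ₐ[ℂ] B) (p : MatProj A) : MatProj B where
  size := p.size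
  mat := p.mat.map φ
  isStarProjection := by
    have h1 : p.matᴴ = p.mat := p.isStarProjection.isSelfAdjoint
    have h2 : p.mat * p.mat = p.mat := p.isStarProjection.isIdempotentElem
    exact ⟨by rw [IsIdempotentElem, ← map_mul', h2],
      by rw [isSelfAdjoint_iff, Matrix.star_eq_conjTranspose, conjTranspose_map, h1]⟩

/-- The homomorphism `V(A) → V(B)` induced by a unital `*`-homomorphism. -/
def ProjMonoid.map (φ : A →⋆ₐ[ℂ] B) : ProjMonoid A →+ ProjMonoid B where
  toFun := Quotient.map (MatProj.map φ) (by
    rintro p q ⟨v, h1, h2⟩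
    have h3 : p.mat.map φ = v.map φ * (v.map φ)ᴴ := by rw [conjTranspose_map, ← map_mul', ← h1]
    have h4 : q.mat.map φ = (v.map φ)ᴴ * v.map φ := by rw [conjTranspose_map, ← map_mul', ← h2]
    exact ⟨v.map φ, h3, h4⟩)
  map_zero' := Quotient.sound (by
    have : (MatProj.map φ (MatProj.zero A)) = MatProj.zero B := by
      unfold MatProj.map MatProj.zero
      congr 1
      ext i
      exact i.elim0
    rw [this])
  map_add' a b := by
    refine Quotient.inductionOn₂ a b fun p q => ?_
    have : (p.directSum q).map φ = (p.map φ).directSum (q.map φ) := by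
      unfold MatProj.map MatProj.directSum
      congr 1
      simp only [Matrix.reindex_apply, ← Matrix.submatrix_map, Matrix.fromBlocks_map]
      congr 2 <;> ext <;> simp
    exact congrArg (Quotient.mk _) this

/-- The homomorphism `K₀₀(A) → K₀₀(B)` induced by a unital `*`-homomorphism. -/
def K00.map (φ : A →⋆ₐ[ℂ] B) : K00 A →+ K00 B :=
  Algebra.GrothendieckAddGroup.lift (K00.of.comp (ProjMonoid.map φ))

theorem K00.map_of (φ : A →⋆ₐ[ℂ] B) (x : ProjMonoid A) :
    K00.map φ (K00.of x) = K00.of (ProjMonoid.map φ x) :=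
  DFunLike.congr_fun (Algebra.GrothendieckAddGroup.lift.symm_apply_apply
    (K00.of.comp (ProjMonoid.map φ))) x

end Functoriality

section NonUnital

variable (A : Type u) [NonUnitalCStarAlgebra A]

/-- The scalar character `A⁺ → ℂ`, `(z, a) ↦ z`, of the unitization `A⁺ = ℂ ⊕ A`. -/
def scalarHom : Unitization ℂ A →⋆ₐ[ℂ] ℂ where
  __ := Unitization.fstHom ℂ A
  map_star' _ := rfl

/-- The group `K₀(A)` of a (not necessarily unital) C*-algebra `A`: the kernel of the map
`K₀(A⁺) → K₀(ℂ)` induced by the scalar character of the unitization. -/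
def K0 : Type u := (K00.map (scalarHom A)).ker

instance K0.instAddCommGroup : AddCommGroup (K0 A) :=
  inferInstanceAs (AddCommGroup (K00.map (scalarHom A)).ker)

variable {A}

/-- A projection of `A`, regarded as a `1 × 1` matrix over the unitization of `A`. -/
def MatProj.ofProj (p : A) (hp : IsStarProjection p) : MatProj (Unitization ℂ A) where
  size := 1
  mat := Matrix.of fun _ _ => (p : Unitization ℂ A)
  isStarProjection := by
    have h1 : star p = p := hp.isSelfAdjoint
    have h2 : p * p = p := hp.isIdempotentElem
    constructor
    · refine Matrix.ext fun i j => ?_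
      simp [Matrix.mul_apply, ← Unitization.inr_mul, h2]
    · refine Matrix.ext fun i j => ?_
      simp [Matrix.star_apply, ← Unitization.inr_star, h1]

theorem ofProj_mem_ker (p : A) (hp : IsStarProjection p) :
    K00.of (ProjMonoid.mk (MatProj.ofProj p hp)) ∈ (K00.map (scalarHom A)).ker := by
  have h : ProjMonoid.map (scalarHom A) (ProjMonoid.mk (MatProj.ofProj p hp)) = 0 := by
    refine Quotient.sound ⟨0, ?_, ?_⟩
    · ext i j
      rw [Matrix.zero_mul]
      exact Unitization.fst_inr ℂ p
    · ext i j
      exact i.elim0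
  rw [AddMonoidHom.mem_ker, K00.map_of, h, map_zero]

/-- The class `[p] ∈ K₀(A)` of a projection `p` of `A`. -/
def K0.ofProj (p : A) (hp : IsStarProjection p) : K0 A :=
  ⟨K00.of (ProjMonoid.mk (MatProj.ofProj p hp)), ofProj_mem_ker p hp⟩

end NonUnital

end KTheory

end

noncomputable section

open MeasureTheory Topology
open scoped ENNReal CompactlySupported

namespace Roe

/-- Euclidean space `ℝ^d`. -/
abbrev Space (d : ℕ) : Type := EuclideanSpace ℝ (Fin d)

/-- The complex Hilbert space `L²(ℝ^d)`. -/
abbrev L2 (d : ℕ) : Type := Lp ℂ 2 (volume : Measure (Space d))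

variable {d : ℕ}

theorem memLp_mul (f : C_c(Space d, ℂ)) (φ : L2 d) :
    MemLp (fun x => f x * φ x) 2 (volume : Measure (Space d)) := by
  obtain ⟨C, hC⟩ := f.hasCompactSupport.exists_bound_of_continuous f.continuous
  refine (Lp.memLp φ).of_le_mul (c := C)
    (f.continuous.aestronglyMeasurable.mul (Lp.aestronglyMeasurable φ)) (.of_forall fun x => ?_)
  rw [norm_mul]
  exact mul_le_mul_of_nonneg_right (hC x) (norm_nonneg _)

/-- The bounded operator on `L²(ℝ^d)` of multiplication by `f ∈ C_c(ℝ^d)`. -/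
def mulOp (f : C_c(Space d, ℂ)) : L2 d →L[ℂ] L2 d :=
  LinearMap.mkContinuousOfExistsBound
    { toFun := fun φ => (memLp_mul f φ).toLp
      map_add' := fun φ ψ => by
        rw [← MemLp.toLp_add]
        refine MemLp.toLp_congr _ _ ?_
        filter_upwards [Lp.coeFn_add φ ψ] with x hx
        rw [hx, Pi.add_apply, mul_add]
        rfl
      map_smul' := fun c φ => by
        rw [RingHom.id_apply, ← MemLp.toLp_const_smul]
        refine MemLp.toLp_congr _ _ ?_
        filter_upwards [Lp.coeFn_smul c φ] with x hx
        simp [hx, mul_left_comm] }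
    (by
      obtain ⟨C, hC⟩ := f.hasCompactSupport.exists_bound_of_continuous f.continuous
      refine ⟨C, fun φ => Lp.norm_le_mul_norm_of_ae_le_mul ?_⟩
      filter_upwards [(memLp_mul f φ).coeFn_toLp] with x hx
      simp only [LinearMap.coe_mk, AddHom.coe_mk, hx, norm_mul]
      exact mul_le_mul_of_nonneg_right (hC x) (norm_nonneg _))

theorem mulOp_ae (f : C_c(Space d, ℂ)) (φ : L2 d) :
    mulOp f φ =ᵐ[volume] fun x => f x * φ x := (memLp_mul f φ).coeFn_toLp

theorem mulOp_mul (f g : C_c(Space d, ℂ)) : mulOp (f * g) = mulOp f * mulOp g := by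
  ext1 φ
  refine Lp.ext ?_
  rw [mul_apply_eq_comp]
  filter_upwards [mulOp_ae (f * g) φ, mulOp_ae f (mulOp g φ), mulOp_ae g φ] with x h1 h2 h3
  rw [h1, h2, h3, CompactlySupportedContinuousMap.mul_apply, mul_assoc]

theorem mulOp_sub (f g : C_c(Space d, ℂ)) : mulOp (f - g) = mulOp f - mulOp g := by
  ext1 φ
  refine Lp.ext ?_
  rw [sub_apply]
  filter_upwards [mulOp_ae (f - g) φ, mulOp_ae f φ, mulOp_ae g φ,
    Lp.coeFn_sub (mulOp f φ) (mulOp g φ)] with x h1 h2 h3 h4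
  rw [h1, h4, Pi.sub_apply, h2, h3, CompactlySupportedContinuousMap.sub_apply, sub_mul]

theorem star_mulOp (f : C_c(Space d, ℂ)) : star (mulOp f) = mulOp (star f) := by
  rw [ContinuousLinearMap.star_eq_adjoint, eq_comm, ContinuousLinearMap.eq_adjoint_iff]
  intro φ ψ
  rw [L2.inner_def, L2.inner_def]
  refine integral_congr_ae ?_
  filter_upwards [mulOp_ae (star f) φ, mulOp_ae f ψ] with x h1 h2
  rw [h1, h2, CompactlySupportedContinuousMap.star_apply]
  simp [mul_comm, mul_left_comm]

/-- The distance `inf {‖x - y‖ : x ∈ A, y ∈ B}` between two subsets (`∞` if one is empty). -/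
def setDist (A B : Set (Space d)) : ℝ≥0∞ := ⨅ x ∈ A, ⨅ y ∈ B, edist x y

theorem lt_setDist_imp {A B : Set (Space d)} {R : ℝ≥0∞} (h : R < setDist A B) {x y : Space d}
    (hx : x ∈ A) (hy : y ∈ B) : R < edist x y :=
  h.trans_le ((iInf₂_le x hx).trans (iInf₂_le y hy))

theorem setDist_comm (A B : Set (Space d)) : setDist A B = setDist B A := by
  unfold setDist
  refine le_antisymm ?_ ?_ <;>
  · refine le_iInf₂ fun x hx => le_iInf₂ fun y hy => ?_
    rw [edist_comm]
    exact (iInf₂_le y hy).trans (iInf₂_le x hx)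

/-- `T` is locally compact: `Tf` and `fT` are compact for every `f ∈ C_c(ℝ^d)`. -/
def IsLocallyCompact (T : L2 d →L[ℂ] L2 d) : Prop :=
  ∀ f : C_c(Space d, ℂ), IsCompactOperator (T * mulOp f : L2 d →L[ℂ] L2 d) ∧
    IsCompactOperator (mulOp f * T : L2 d →L[ℂ] L2 d)

/-- `T` has propagation (at most) `R`: `fTg = 0` for all `f, g ∈ C_c(ℝ^d)` whose supports are at
distance more than `R`. -/
def HasPropagation (T : L2 d →L[ℂ] L2 d) (R : ℝ) : Prop :=
  ∀ f g : C_c(Space d, ℂ), ENNReal.ofReal R < setDist (tsupport f) (tsupport g) →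
    mulOp f * T * mulOp g = 0

/-- `T` has finite propagation. -/
def HasFinitePropagation (T : L2 d →L[ℂ] L2 d) : Prop := ∃ R : ℝ, 0 < R ∧ HasPropagation T R

theorem isCompactOperator_star {T : L2 d →L[ℂ] L2 d} (hT : IsCompactOperator T) :
    IsCompactOperator (star T : L2 d →L[ℂ] L2 d) := by
  have hTT : IsCompactOperator (T * star T : L2 d →L[ℂ] L2 d) := hT.comp_clm (star T)
  have hK : IsCompact (closure ((T * star T : L2 d →L[ℂ] L2 d) '' Metric.closedBall 0 1)) :=
    IsCompactOperator.isCompact_closure_image_closedBall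
      (f := (T * star T : L2 d →L[ℂ] L2 d).toLinearMap) hTT 1
  refine (isCompactOperator_iff_isCompact_closure_image_closedBall
    ((star T : L2 d →L[ℂ] L2 d).toLinearMap) one_pos).2 ?_
  have hbd : ∀ x y : L2 d, x ∈ Metric.closedBall (0 : L2 d) 1 →
      y ∈ Metric.closedBall (0 : L2 d) 1 →
      ‖star T x - star T y‖ ^ 2 ≤ 2 * ‖(T * star T) x - (T * star T) y‖ := by
    intro x y hx hy
    rw [mem_closedBall_zero_iff] at hx hy
    have h1 : ‖x - y‖ ≤ 2 := (norm_sub_le x y).trans (by linarith)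
    have h2 : star T x - star T y = star T (x - y) := (map_sub _ _ _).symm
    have h3 : (T * star T) x - (T * star T) y = T (star T (x - y)) := (map_sub (T * star T) x y).symm
    rw [h2, h3]
    have h4 : inner ℂ (star T (x - y)) (star T (x - y)) = inner ℂ (x - y) (T (star T (x - y))) := by
      rw [ContinuousLinearMap.star_eq_adjoint, ContinuousLinearMap.adjoint_inner_left]
    calc ‖star T (x - y)‖ ^ 2 = ‖(inner ℂ (star T (x - y)) (star T (x - y)) : ℂ)‖ := by
          rw [inner_self_eq_norm_sq_to_K]; simp
      _ = ‖(inner ℂ (x - y) (T (star T (x - y))) : ℂ)‖ := by rw [h4]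
      _ ≤ ‖x - y‖ * ‖T (star T (x - y))‖ := norm_inner_le_norm _ _
      _ ≤ 2 * ‖T (star T (x - y))‖ := by gcongr
  have htb : TotallyBounded ((T * star T : L2 d →L[ℂ] L2 d) '' Metric.closedBall 0 1) :=
    hK.totallyBounded.subset subset_closure
  refine (TotallyBounded.closure ?_).isCompact_of_isClosed isClosed_closure
  rw [Metric.totallyBounded_iff]
  intro ε hε
  obtain ⟨t, ht, htf, hcov⟩ := Metric.finite_approx_of_totallyBounded htb (ε ^ 2 / 2) (by positivity)
  have ht' : ∀ y ∈ t, ∃ x : L2 d, x ∈ Metric.closedBall (0 : L2 d) 1 ∧ (T * star T) x = y :=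
    fun y hy => ht hy
  choose! g hgB hg using ht'
  refine ⟨(fun y => star T (g y)) '' t, htf.image _, ?_⟩
  rintro _ ⟨x, hx, rfl⟩
  obtain ⟨y, hyt, hy⟩ := Set.mem_iUnion₂.1 (hcov ⟨x, hx, rfl⟩)
  refine Set.mem_iUnion₂.2 ⟨star T (g y), ⟨y, hyt, rfl⟩, ?_⟩
  have h1 := hbd x (g y) hx (hgB y hyt)
  rw [hg y hyt] at h1
  rw [Metric.mem_ball, dist_eq_norm] at hy ⊢
  refine lt_of_pow_lt_pow_left₀ 2 hε.le (lt_of_le_of_lt h1 ?_)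
  linarith

theorem exists_cutoff {K : Set (Space d)} (hK : IsCompact K) (hK0 : K.Nonempty) (a : ℝ) {δ : ℝ} (hδ : 0 < δ) :
    ∃ χ : C_c(Space d, ℂ), (∀ x, Metric.infDist x K ≤ a + δ → χ x = 1) ∧
      ∀ x ∈ tsupport χ, Metric.infDist x K ≤ a + 2 * δ := by
  let u : Space d → ℝ := fun x => max 0 (min 1 ((a + 2 * δ - Metric.infDist x K) / δ))
  have hu : Continuous u := by
    have := Metric.continuous_infDist_pt K
    fun_prop
  have hsupp : Function.support (fun x => (u x : ℂ)) ⊆ {x | Metric.infDist x K ≤ a + 2 * δ} := by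
    intro x hx
    by_contra hlt
    rw [Set.mem_ofPred_eq, not_le] at hlt
    refine hx ?_
    have h1 : (a + 2 * δ - Metric.infDist x K) / δ ≤ 0 :=
      div_nonpos_of_nonpos_of_nonneg (by linarith) hδ.le
    have h2 : u x = 0 := max_eq_left ((min_le_right _ _).trans h1)
    simp only [h2, Complex.ofReal_zero]
  have hclosed : IsClosed {x : Space d | Metric.infDist x K ≤ a + 2 * δ} :=
    isClosed_le (Metric.continuous_infDist_pt K) continuous_const
  have hcomp : IsCompact {x : Space d | Metric.infDist x K ≤ a + 2 * δ} := by
    refine Metric.isCompact_of_isClosed_isBounded hclosed ?_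
    obtain ⟨y, hy⟩ := hK0
    obtain ⟨C, hC⟩ := hK.isBounded.subset_closedBall y
    refine (Metric.isBounded_closedBall (x := y) (r := a + 2 * δ + C)).subset fun x hx => ?_
    obtain ⟨z, hz, hxz⟩ := hK.exists_infDist_eq_dist ⟨y, hy⟩ x
    have h1 : dist x z ≤ a + 2 * δ := hxz ▸ hx
    have h2 : dist z y ≤ C := hC hz
    exact (dist_triangle x z y).trans (add_le_add h1 h2)
  refine ⟨⟨⟨fun x => (u x : ℂ), Complex.continuous_ofReal.comp hu⟩,
    hcomp.of_isClosed_subset (isClosed_tsupport _) (closure_minimal hsupp hclosed)⟩,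
    fun x hx => ?_, fun x hx => closure_minimal hsupp hclosed hx⟩
  have h1 : 1 ≤ (a + 2 * δ - Metric.infDist x K) / δ := by
    rw [le_div_iff₀ hδ]
    linarith
  have h2 : u x = 1 := by
    simp only [u, min_eq_left h1]
    norm_num
  change (u x : ℂ) = 1
  rw [h2, Complex.ofReal_one]

theorem eq_zero_of_mulOp {ψ : L2 d} (h : ∀ f : C_c(Space d, ℂ), mulOp f ψ = 0) : ψ = 0 := by
  have hn : ∀ n : ℕ, ∀ᵐ x ∂(volume : Measure (Space d)), ‖x‖ ≤ n → ψ x = 0 := by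
    intro n
    obtain ⟨χ, hχ, -⟩ := exists_cutoff (K := {(0 : Space d)}) isCompact_singleton
      (Set.singleton_nonempty _) n one_pos
    have h0 : mulOp χ ψ =ᵐ[volume] (0 : Space d → ℂ) := by
      rw [h χ]
      exact Lp.coeFn_zero _ _ _
    filter_upwards [mulOp_ae χ ψ, h0] with x h1 h2 hx
    rw [h1, hχ x (by rw [Metric.infDist_singleton, dist_zero_right]; linarith), one_mul] at h2
    exact h2
  rw [Lp.eq_zero_iff_ae_eq_zero]
  filter_upwards [ae_all_iff.2 hn] with x hx
  obtain ⟨n, hxn⟩ := exists_nat_ge ‖x‖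
  exact hx n hxn

theorem HasPropagation.mono {T : L2 d →L[ℂ] L2 d} {R R' : ℝ} (h : HasPropagation T R)
    (hR : R ≤ R') : HasPropagation T R' :=
  fun f g hfg => h f g ((ENNReal.ofReal_le_ofReal hR).trans_lt hfg)

theorem HasPropagation.star {T : L2 d →L[ℂ] L2 d} {R : ℝ} (h : HasPropagation T R) :
    HasPropagation (star T) R := by
  intro f g hfg
  have hs : ∀ k : C_c(Space d, ℂ), tsupport (Star.star k : C_c(Space d, ℂ)) = tsupport k := by
    intro k
    unfold tsupport
    congr 1
    ext x
    simp
  have := congrArg Star.star (h (Star.star g) (Star.star f)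
    (by rw [hs, hs, setDist_comm]; exact hfg))
  simpa [star_mulOp, mul_assoc] using this

theorem HasPropagation.mul {T S : L2 d →L[ℂ] L2 d} {R₁ R₂ : ℝ} (h₁ : 0 ≤ R₁) (h₂ : 0 ≤ R₂)
    (hT : HasPropagation T R₁) (hS : HasPropagation S R₂) :
    HasPropagation (T * S) (R₁ + R₂) := by
  intro f g hfg
  rcases (tsupport g).eq_empty_or_nonempty with hg | hg
  · have hg0 : g = 0 := by
      ext x
      exact congrFun (tsupport_eq_empty_iff.1 hg) x
    have h0 : mulOp g = 0 := by
      have := mulOp_sub g g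
      rwa [sub_self, sub_self, ← hg0] at this
    rw [h0, mul_zero]
  have hK : IsCompact (tsupport g) := g.hasCompactSupport
  obtain ⟨c, hc0, hc1, hc2⟩ := ENNReal.lt_iff_exists_real_btwn.1 hfg
  have hc : R₁ + R₂ < c := (ENNReal.ofReal_lt_ofReal_iff_of_nonneg (add_nonneg h₁ h₂)).1 hc1
  obtain ⟨δ, hδ⟩ : ∃ δ, δ = (c - R₁ - R₂) / 3 := ⟨_, rfl⟩
  have hδ0 : 0 < δ := by rw [hδ]; linarith
  obtain ⟨χ, hχ1, hχ2⟩ := exists_cutoff hK hg R₂ hδ0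
  have hA : mulOp f * T * mulOp χ = 0 := by
    refine hT f χ ?_
    refine lt_of_lt_of_le (b := ENNReal.ofReal (R₁ + δ)) ?_ ?_
    · exact (ENNReal.ofReal_lt_ofReal_iff_of_nonneg h₁).2 (by linarith)
    · refine le_iInf₂ fun x hx => le_iInf₂ fun z hz => ?_
      obtain ⟨y, hy, hzy⟩ := hK.exists_infDist_eq_dist hg z
      have h3 := hχ2 z hz
      have h4 := lt_setDist_imp hc2 hx hy
      rw [edist_dist, ENNReal.ofReal_lt_ofReal_iff_of_nonneg hc0] at h4
      rw [edist_dist]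
      refine ENNReal.ofReal_le_ofReal ?_
      have h5 := dist_triangle x z y
      rw [hzy] at h3
      linarith
  have hB : ∀ φ, S (mulOp g φ) = mulOp χ (S (mulOp g φ)) := by
    intro φ
    rw [← sub_eq_zero]
    refine eq_zero_of_mulOp fun h => ?_
    have h3 : mulOp (h - h * χ) * S * mulOp g = 0 := by
      refine hS _ _ ?_
      refine lt_of_lt_of_le (b := ENNReal.ofReal (R₂ + δ)) ?_ ?_
      · exact (ENNReal.ofReal_lt_ofReal_iff_of_nonneg h₂).2 (by linarith)
      · refine le_iInf₂ fun x hx => le_iInf₂ fun y hy => ?_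
        have h4 : tsupport (h - h * χ : C_c(Space d, ℂ)) ⊆
            {x | R₂ + δ ≤ Metric.infDist x (tsupport g)} := by
          refine closure_minimal (fun z hz => ?_)
            (isClosed_le continuous_const (Metric.continuous_infDist_pt _))
          by_contra hlt
          rw [Set.mem_ofPred_eq, not_le] at hlt
          refine hz ?_
          rw [CompactlySupportedContinuousMap.sub_apply,
            CompactlySupportedContinuousMap.mul_apply, hχ1 z hlt.le, mul_one, sub_self]
        rw [edist_dist]
        exact ENNReal.ofReal_le_ofReal ((h4 hx).trans (Metric.infDist_le_dist_of_mem hy))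
    have h5 := DFunLike.congr_fun h3 φ
    rw [mulOp_sub, mulOp_mul] at h5
    rw [map_sub]
    exact h5
  ext1 φ
  have h6 := DFunLike.congr_fun hA (S (mulOp g φ))
  calc (mulOp f * (T * S) * mulOp g) φ = mulOp f (T (S (mulOp g φ))) := rfl
    _ = mulOp f (T (mulOp χ (S (mulOp g φ)))) := by rw [← hB]
    _ = 0 := h6

/-- The `*`-algebra `ℂ[ℝ^d]` of locally compact operators with finite propagation. -/
def algebraicRoe (d : ℕ) : NonUnitalStarSubalgebra ℂ (L2 d →L[ℂ] L2 d) where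
  carrier := {T | IsLocallyCompact T ∧ HasFinitePropagation T}
  add_mem' := by
    rintro T S ⟨hT, R₁, hR₁, hT'⟩ ⟨hS, R₂, hR₂, hS'⟩
    refine ⟨fun f => ⟨?_, ?_⟩, max R₁ R₂, lt_max_of_lt_left hR₁, fun f g hfg => ?_⟩
    · rw [add_mul]
      exact (hT f).1.add (hS f).1
    · rw [mul_add]
      exact (hT f).2.add (hS f).2
    · rw [mul_add, add_mul, hT'.mono (le_max_left _ _) f g hfg,
        hS'.mono (le_max_right _ _) f g hfg, add_zero]
  zero_mem' := by
    refine ⟨fun f => ⟨?_, ?_⟩, 1, one_pos, fun f g _ => ?_⟩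
    · rw [zero_mul]
      exact isCompactOperator_zero
    · rw [mul_zero]
      exact isCompactOperator_zero
    · rw [mul_zero, zero_mul]
  mul_mem' := by
    rintro T S ⟨hT, R₁, hR₁, hT'⟩ ⟨hS, R₂, hR₂, hS'⟩
    refine ⟨fun f => ⟨?_, ?_⟩, R₁ + R₂, add_pos hR₁ hR₂, hT'.mul hR₁.le hR₂.le hS'⟩
    · rw [mul_assoc]
      exact (hS f).1.clm_comp T
    · rw [← mul_assoc]
      exact (hT f).2.comp_clm S
  smul_mem' := by
    rintro c T ⟨hT, R, hR, hT'⟩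
    refine ⟨fun f => ⟨?_, ?_⟩, R, hR, fun f g hfg => ?_⟩
    · rw [smul_mul_assoc]
      exact (hT f).1.smul c
    · rw [mul_smul_comm]
      exact (hT f).2.smul c
    · rw [mul_smul_comm, smul_mul_assoc, hT' f g hfg, smul_zero]
  star_mem' := by
    rintro T ⟨hT, R, hR, hT'⟩
    refine ⟨fun f => ⟨?_, ?_⟩, R, hR, hT'.star⟩
    · have := isCompactOperator_star (hT (star f)).2
      rwa [star_mul, star_mulOp, star_star] at this
    · have := isCompactOperator_star (hT (star f)).1
      rwa [star_mul, star_mulOp, star_star] at this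

/-- The Roe C*-algebra `C*(ℝ^d)`, the norm closure of `ℂ[ℝ^d]` in `B(L²(ℝ^d))`. -/
def roeAlgebra (d : ℕ) : NonUnitalStarSubalgebra ℂ (L2 d →L[ℂ] L2 d) :=
  (algebraicRoe d).topologicalClosure

instance isClosed_roeAlgebra (d : ℕ) : IsClosed (roeAlgebra d : Set (L2 d →L[ℂ] L2 d)) :=
  (algebraicRoe d).isClosed_topologicalClosure

instance roeAlgebra.instNonUnitalCStarAlgebra (d : ℕ) : NonUnitalCStarAlgebra (roeAlgebra d) :=
  NonUnitalStarSubalgebra.nonUnitalCStarAlgebra (roeAlgebra d)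

/-- `𝔇` is `r`-uniformly discrete: `r > 0` and the open balls `B_r(γ)`, `γ ∈ 𝔇`, are disjoint. -/
def IsUniformlyDiscrete (r : ℝ) (𝔇 : Set (Space d)) : Prop :=
  0 < r ∧ 𝔇.PairwiseDisjoint fun γ => Metric.ball γ r

/-- The (essential, closed) support of `φ ∈ L²(ℝ^d)`: the complement of the largest open set on
which `φ` vanishes almost everywhere. -/
def essSupport (φ : L2 d) : Set (Space d) :=
  {x | ∀ U ∈ 𝓝 x, ¬ ∀ᵐ y ∂(volume : Measure (Space d)), y ∈ U → φ y = 0}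

/-- `φ` is an extremely localized generalized Wannier basis of `H` around the `r`-uniformly
discrete set `𝔇`: an orthonormal basis of `H` with `supp φ_γ ⊆ B_r(γ)`. -/
structure IsExtremelyLocalizedGWB (H : ClosedSubmodule ℂ (L2 d)) (r : ℝ) (𝔇 : Set (Space d))
    (φ : 𝔇 → L2 d) : Prop where
  isUniformlyDiscrete : IsUniformlyDiscrete r 𝔇
  orthonormal : Orthonormal ℂ φ
  closure_span : (Submodule.span ℂ (Set.range φ)).topologicalClosure = H.toSubmodule
  essSupport_subset : ∀ γ : 𝔇, essSupport (φ γ) ⊆ Metric.ball (γ : Space d) r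

end Roe

end

/-! ### Murray–von Neumann classes and the abstract swindle -/

noncomputable section

open scoped Matrix

namespace KTheory

variable {A : Type*} [NonUnitalCStarAlgebra A]

/-! The projection is `∑ |φ_γ⟩⟨φ_γ|`. Cutting it by a compactly supported function leaves only
finitely many terms, since a uniformly discrete set is locally finite; this gives local compactness.
Each term only connects points of a single ball of radius `r`, which gives propagation `2r`.

The K-theory class vanishes by an Eilenberg swindle that pushes mass to infinity. From each `γ` a
ray `γ + n u_γ` is drawn, with the unit vector `u_γ` at a non-obtuse angle to `γ`. Then `‖γ + n
u_γ‖² ≥ ‖γ‖² + n²`, so the points of all rays together form a locally finite family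
(`IsUniformlyDiscrete.exists_rays`). Near these points sits an auxiliary orthonormal family
`ψ_(γ,n)`, supported in balls of one fixed radius (`exists_orthonormal_vanishesOff_ball`). The shift
`s = ∑ |ψ_(γ,n+1)⟩⟨ψ_(γ,n)|` and the operator `v = ∑ |φ_γ⟩⟨ψ_(γ,0)|` are locally compact of finite
propagation, by the same argument as for the projection itself. With `q₀ = v* v` one has `s* s = q₀
+ s s*`, an orthogonal sum, hence `[s* s] = [q₀] + [s* s]` and `[P] = [q₀] = 0`
(`K0.ofProj_eq_zero_of_swindle`).

Since `φ` is compared with `ψ` only through the equivalence `v`, no orthogonality between the two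
families is needed. -/

theorem of_const_mul {R : Type*} [Ring R] (x y : R) :
    (Matrix.of fun _ _ => x : Matrix (Fin 1) (Fin 1) R) * (Matrix.of fun _ _ => y) =
      Matrix.of fun _ _ => x * y := by
  ext
  simp [Matrix.mul_apply]

theorem of_const_conjTranspose {R : Type*} [Ring R] [StarRing R] (x : R) :
    (Matrix.of fun _ _ => x : Matrix (Fin 1) (Fin 1) R)ᴴ = Matrix.of fun _ _ => star x := by
  ext
  simp

/-- Murray-von Neumann equivalent projections of `A` have the same class in `V(A⁺)`. -/
theorem mk_ofProj_eq_of_mul_star {p q : A} (hp : IsStarProjection p) (hq : IsStarProjection q)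
    (v : A) (h₁ : p = v * star v) (h₂ : q = star v * v) :
    ProjMonoid.mk (MatProj.ofProj p hp) = ProjMonoid.mk (MatProj.ofProj q hq) := by
  have key : MvNEquiv (Matrix.of fun _ _ => (p : Unitization ℂ A) : Matrix (Fin 1) (Fin 1) _)
      (Matrix.of fun _ _ => (q : Unitization ℂ A) : Matrix (Fin 1) (Fin 1) _) := by
    refine ⟨Matrix.of fun _ _ => (v : Unitization ℂ A), ?_, ?_⟩
    · rw [of_const_conjTranspose, of_const_mul, ← Unitization.inr_star, ← Unitization.inr_mul, h₁]
    · rw [of_const_conjTranspose, of_const_mul, ← Unitization.inr_star, ← Unitization.inr_mul, h₂]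
  exact Quotient.sound key

/-- A sum of two orthogonal projections is Murray-von Neumann equivalent to their direct sum. -/
theorem MvNEquiv.add_fromBlocks {R n : Type*} [Ring R] [StarRing R] [Fintype n]
    {p q : Matrix n n R} (hp : IsStarProjection p) (hq : IsStarProjection q) (hpq : p * q = 0) :
    MvNEquiv (p + q) (Matrix.fromBlocks p 0 0 q) := by
  have hp1 : pᴴ = p := hp.isSelfAdjoint
  have hq1 : qᴴ = q := hq.isSelfAdjoint
  have hp2 : p * p = p := hp.isIdempotentElem
  have hq2 : q * q = q := hq.isIdempotentElem
  have hqp : q * p = 0 := by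
    have := congrArg Matrix.conjTranspose hpq
    rwa [Matrix.conjTranspose_mul, hp1, hq1, Matrix.conjTranspose_zero] at this
  -- For the row `v = (p q)`, the off-diagonal entries of `v* v` are `pq` and `qp`, which vanish by
  -- orthogonality.
  refine ⟨Matrix.fromCols p q, ?_, ?_⟩
  · rw [Matrix.conjTranspose_fromCols_eq_fromRows_conjTranspose, Matrix.fromCols_mul_fromRows,
      hp1, hq1, hp2, hq2]
  · rw [Matrix.conjTranspose_fromCols_eq_fromRows_conjTranspose, Matrix.fromRows_mul_fromCols,
      hp1, hq1, hp2, hq2, hpq, hqp]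

/-- The class of a sum of two orthogonal projections is the sum of the classes. -/
theorem mk_ofProj_add {p q s : A} (hp : IsStarProjection p) (hq : IsStarProjection q)
    (hs : IsStarProjection s) (h : s = p + q) (hpq : p * q = 0) :
    ProjMonoid.mk (MatProj.ofProj s hs) =
      ProjMonoid.mk (MatProj.ofProj p hp) + ProjMonoid.mk (MatProj.ofProj q hq) := by
  have hpq' : (Matrix.of fun _ _ => (p : Unitization ℂ A) : Matrix (Fin 1) (Fin 1) _) *
      (Matrix.of fun _ _ => (q : Unitization ℂ A)) = 0 := by
    rw [of_const_mul, ← Unitization.inr_mul, hpq]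
    rfl
  have hsum : (Matrix.of fun _ _ => (s : Unitization ℂ A) : Matrix (Fin 1) (Fin 1) _) =
      (Matrix.of fun _ _ => (p : Unitization ℂ A)) + Matrix.of fun _ _ => (q : Unitization ℂ A) := by
    ext1 i j
    rw [Matrix.add_apply, Matrix.of_apply, Matrix.of_apply, Matrix.of_apply, h,
      Unitization.inr_add]
  have key : MvNEquiv (Matrix.of fun _ _ => (s : Unitization ℂ A) : Matrix (Fin 1) (Fin 1) _)
      (Matrix.fromBlocks (Matrix.of fun _ _ => (p : Unitization ℂ A) : Matrix (Fin 1) (Fin 1) _) 0 0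
        (Matrix.of fun _ _ => (q : Unitization ℂ A) : Matrix (Fin 1) (Fin 1) _)) := by
    rw [hsum]
    exact MvNEquiv.add_fromBlocks (MatProj.ofProj p hp).isStarProjection
      (MatProj.ofProj q hq).isStarProjection hpq'
  exact Quotient.sound (MvNEquiv.trans (MatProj.ofProj s hs).isStarProjection
    ((MatProj.ofProj p hp).directSum (MatProj.ofProj q hq)).isStarProjection
    key
    (MatProj.directSum_equiv (MatProj.ofProj p hp) (MatProj.ofProj q hq)).symm)

/-- **Eilenberg swindle.** If `s* s = q₀ + s s*` with `q₀ ⊥ s s*`, then a projection equivalent to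
`q₀` has trivial class in `K₀(A)`. -/
theorem K0.ofProj_eq_zero_of_swindle {p q₀ s v : A} (hp : IsStarProjection p)
    (hq₀ : IsStarProjection q₀) (hs : IsStarProjection (s * star s))
    (hs' : IsStarProjection (star s * s)) (hpv : p = v * star v) (hqv : q₀ = star v * v)
    (hsum : star s * s = q₀ + s * star s) (horth : q₀ * (s * star s) = 0) :
    K0.ofProj p hp = 0 := by
  have h1 := mk_ofProj_eq_of_mul_star hp hq₀ v hpv hqv
  have h2 := mk_ofProj_eq_of_mul_star hs hs' s rfl rfl
  have h3 := congrArg K00.of (mk_ofProj_add hq₀ hs hs' hsum horth)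
  -- The cancellation takes place in the Grothendieck group; the monoid of projections need not be
  -- cancellative.
  rw [map_add, h2, right_eq_add, ← h1] at h3
  exact Subtype.ext h3

end KTheory

/-! ### Partial isometries between orthonormal families -/

section PartialIsometry

variable {𝕜 E ι κ : Type*} [RCLike 𝕜] [NormedAddCommGroup E] [InnerProductSpace 𝕜 E]
  [CompleteSpace E]

namespace Orthonormal

/-- The isometry `ℓ²(ι) → E` determined by an orthonormal family. -/
def lpIsometry {a : ι → E} (ha : Orthonormal 𝕜 a) : lp (fun _ : ι => 𝕜) 2 →L[𝕜] E :=
  ha.orthogonalFamily.linearIsometry.toContinuousLinearMap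

theorem hasSum_lpIsometry {a : ι → E} (ha : Orthonormal 𝕜 a) (f : lp (fun _ : ι => 𝕜) 2) :
    HasSum (fun i => f i • a i) (ha.lpIsometry f) := by
  have h := ha.orthogonalFamily.hasSum_linearIsometry f
  simp only [LinearIsometry.toSpanSingleton_apply] at h
  exact h

theorem adjoint_lpIsometry_comp_self {a : ι → E} (ha : Orthonormal 𝕜 a) :
    ContinuousLinearMap.adjoint ha.lpIsometry ∘L ha.lpIsometry = 1 :=
  ContinuousLinearMap.norm_map_iff_adjoint_comp_self _ |>.1
    ha.orthogonalFamily.linearIsometry.norm_map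

theorem adjoint_lpIsometry_apply {a : ι → E} (ha : Orthonormal 𝕜 a) (x : E) (i : ι) :
    ContinuousLinearMap.adjoint ha.lpIsometry x i = inner 𝕜 (a i) x := by
  classical
  have h := ContinuousLinearMap.adjoint_inner_right ha.lpIsometry (lp.single 2 i (1 : 𝕜)) x
  have h1 : ha.lpIsometry (lp.single 2 i (1 : 𝕜)) = a i := by
    change ha.orthogonalFamily.linearIsometry _ = _
    rw [OrthogonalFamily.linearIsometry_apply_single]
    simp [LinearIsometry.toSpanSingleton_apply]
  rw [h1, lp.inner_single_left] at h
  simpa using h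

/-- The partial isometry `∑ i, |a i⟩⟨b i|` taking the orthonormal family `b` to the orthonormal
family `a`. -/
def partialIsometry {a b : ι → E} (ha : Orthonormal 𝕜 a) (hb : Orthonormal 𝕜 b) : E →L[𝕜] E :=
  ha.lpIsometry ∘L ContinuousLinearMap.adjoint hb.lpIsometry

theorem hasSum_partialIsometry {a b : ι → E} (ha : Orthonormal 𝕜 a) (hb : Orthonormal 𝕜 b)
    (x : E) : HasSum (fun i => inner 𝕜 (b i) x • a i) (ha.partialIsometry hb x) := by
  have h := ha.hasSum_lpIsometry (ContinuousLinearMap.adjoint hb.lpIsometry x)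
  simp only [adjoint_lpIsometry_apply] at h
  exact h

theorem inner_partialIsometry {a b : ι → E} (ha : Orthonormal 𝕜 a) (hb : Orthonormal 𝕜 b)
    (x : E) (i : ι) : inner 𝕜 (a i) (ha.partialIsometry hb x) = inner 𝕜 (b i) x := by
  rw [← adjoint_lpIsometry_apply ha, ← adjoint_lpIsometry_apply hb]
  exact congrArg (fun f : lp (fun _ : ι => 𝕜) 2 => f i) (DFunLike.congr_fun
    ha.adjoint_lpIsometry_comp_self (ContinuousLinearMap.adjoint hb.lpIsometry x))

theorem star_partialIsometry {a b : ι → E} (ha : Orthonormal 𝕜 a) (hb : Orthonormal 𝕜 b) :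
    star (ha.partialIsometry hb) = hb.partialIsometry ha := by
  rw [ContinuousLinearMap.star_eq_adjoint, partialIsometry, ContinuousLinearMap.adjoint_comp,
    ContinuousLinearMap.adjoint_adjoint, partialIsometry]

/-- Writing `V_a` for the isometry of `a`, this is `V_a (V_b* V_b) V_c* = V_a V_c*`. Together with
`star_partialIsometry` it yields the formulas for `v v*`, `v* v`, `s s*` and `s* s` in the swindle.
-/
theorem partialIsometry_mul {a b c : ι → E} (ha : Orthonormal 𝕜 a) (hb : Orthonormal 𝕜 b)
    (hc : Orthonormal 𝕜 c) :
    ha.partialIsometry hb * hb.partialIsometry hc = ha.partialIsometry hc := by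
  ext x
  exact congrArg ha.lpIsometry (DFunLike.congr_fun hb.adjoint_lpIsometry_comp_self
    (ContinuousLinearMap.adjoint hc.lpIsometry x))

theorem isStarProjection_partialIsometry {a : ι → E} (ha : Orthonormal 𝕜 a) :
    IsStarProjection (ha.partialIsometry ha) :=
  ⟨ha.partialIsometry_mul ha ha, ha.star_partialIsometry ha⟩

/-- The two index types are independent because the swindle pairs a family indexed by `𝔇` with one
indexed by `𝔇 × ℕ`. -/
theorem partialIsometry_mul_eq_zero {a b : ι → E} {c e : κ → E} (ha : Orthonormal 𝕜 a)
    (hb : Orthonormal 𝕜 b) (hc : Orthonormal 𝕜 c) (he : Orthonormal 𝕜 e)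
    (h : ∀ i j, inner 𝕜 (b i) (c j) = 0) :
    ha.partialIsometry hb * hc.partialIsometry he = 0 := by
  ext x
  refine (ha.hasSum_partialIsometry hb (hc.partialIsometry he x)).unique ?_
  have h0 : ∀ i, inner 𝕜 (b i) (hc.partialIsometry he x) = 0 := fun i => by
    have := (hc.hasSum_partialIsometry he x).mapL (innerSL 𝕜 (b i))
    simp only [map_smul, innerSL_apply_apply, h, smul_zero] at this
    exact this.unique hasSum_zero
  have h1 : (fun i => inner 𝕜 (b i) (hc.partialIsometry he x) • a i) = fun _ => (0 : E) :=
    funext fun i => by rw [h0, zero_smul]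
  rw [h1]
  exact hasSum_zero

/-- The image of `x` lies in the closed subspace `K` as a limit of finite sums, and by
`inner_partialIsometry` it has the same coefficients as `x`, so the difference is orthogonal to the
span of `a` and to its closure. -/
theorem partialIsometry_self_eq_starProjection {a : ι → E} (ha : Orthonormal 𝕜 a)
    (K : Submodule 𝕜 E) [K.HasOrthogonalProjection]
    (hK : (Submodule.span 𝕜 (Set.range a)).topologicalClosure = K) :
    ha.partialIsometry ha = K.starProjection := by
  ext x
  have hmem : ∀ i, a i ∈ K := fun i =>
    hK ▸ Submodule.le_topologicalClosure _ (Submodule.subset_span ⟨i, rfl⟩)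
  refine Submodule.eq_starProjection_of_mem_orthogonal ?_ ?_ |>.symm
  · have hcl : IsClosed (K : Set E) := hK ▸ Submodule.isClosed_topologicalClosure _
    refine hcl.mem_of_tendsto (ha.hasSum_partialIsometry ha x) (.of_forall fun s => ?_)
    exact K.sum_mem fun i _ => K.smul_mem _ (hmem i)
  · rw [← hK, Submodule.orthogonal_closure, Submodule.mem_orthogonal]
    intro u hu
    induction hu using Submodule.span_induction with
    | mem _ h =>
      obtain ⟨i, rfl⟩ := h
      rw [inner_sub_right, inner_partialIsometry, sub_self]
    | zero => exact inner_zero_left _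
    | add u v _ _ hu hv => rw [inner_add_left, hu, hv, add_zero]
    | smul c u _ hu => rw [inner_smul_left, hu, mul_zero]

/-- Splitting an orthonormal family in two parts splits the projection onto its span. -/
theorem partialIsometry_self_eq_add {σ τ : Type*} {a : ι → E} (ha : Orthonormal 𝕜 a)
    {f : σ → ι} {g : τ → ι}
    (hf : f.Injective) (hg : g.Injective) (h : IsCompl (Set.range f) (Set.range g)) :
    ha.partialIsometry ha = (ha.comp f hf).partialIsometry (ha.comp f hf) +
      (ha.comp g hg).partialIsometry (ha.comp g hg) := by
  ext x
  refine (ha.hasSum_partialIsometry ha x).unique ?_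
  have h₁ := (ha.comp f hf).hasSum_partialIsometry (ha.comp f hf) x
  have h₂ := (ha.comp g hg).hasSum_partialIsometry (ha.comp g hg) x
  exact HasSum.add_isCompl h
    ((hf.hasSum_range_iff (f := fun i => inner 𝕜 (a i) x • a i)).2 h₁)
    ((hg.hasSum_range_iff (f := fun i => inner 𝕜 (a i) x • a i)).2 h₂)

end Orthonormal

end PartialIsometry

end

/-! ### Localized families: local compactness, propagation, existence -/

noncomputable section

open MeasureTheory Topology
open scoped ENNReal CompactlySupported

namespace Roe

variable {d : ℕ}

/-- `ψ` vanishes almost everywhere outside `s`. -/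
def VanishesOff (ψ : L2 d) (s : Set (Space d)) : Prop :=
  ∀ᵐ y ∂(volume : Measure (Space d)), y ∉ s → ψ y = 0

/-- Each point outside the essential support has a neighbourhood on which `ψ` vanishes almost
everywhere; by second countability, a set that is locally null is null. -/
theorem vanishesOff_of_essSupport_subset {ψ : L2 d} {s : Set (Space d)} (h : essSupport ψ ⊆ s) :
    VanishesOff ψ s := by
  have h0 : volume {y | y ∉ s ∧ ψ y ≠ 0} = 0 := by
    refine measure_null_of_locally_null _ fun x hx => ?_
    have hx' : x ∉ essSupport ψ := fun h' => hx.1 (h h')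
    simp only [essSupport, Set.mem_ofPred_eq, not_forall, not_not] at hx'
    obtain ⟨U, hU, hUψ⟩ := hx'
    refine ⟨U ∩ {y | y ∉ s ∧ ψ y ≠ 0}, Filter.inter_mem (mem_nhdsWithin_of_mem_nhds hU)
      self_mem_nhdsWithin, ?_⟩
    refine measure_mono_null (fun y hy => ?_) hUψ
    exact fun h' => hy.2.2 (h' hy.1)
  refine measure_mono_null (fun y hy => ?_) h0
  exact Classical.not_imp.1 hy

theorem VanishesOff.mulOp_eq_zero {ψ : L2 d} {s : Set (Space d)} (h : VanishesOff ψ s)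
    {f : C_c(Space d, ℂ)} (hf : Disjoint s (tsupport f)) : mulOp f ψ = 0 := by
  rw [Lp.eq_zero_iff_ae_eq_zero]
  filter_upwards [h, mulOp_ae f ψ] with y h1 h2
  rw [h2]
  by_cases hy : y ∈ s
  · rw [image_eq_zero_of_notMem_tsupport (Set.disjoint_left.1 hf hy), zero_mul]
    rfl
  · rw [h1 hy, mul_zero]
    rfl

theorem inner_mulOp (ψ v : L2 d) (g : C_c(Space d, ℂ)) :
    inner ℂ ψ (mulOp g v) = inner ℂ (mulOp (star g) ψ) v := by
  rw [← star_mulOp, ContinuousLinearMap.star_eq_adjoint, ContinuousLinearMap.adjoint_inner_left]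

theorem tsupport_star (g : C_c(Space d, ℂ)) :
    tsupport (star g : C_c(Space d, ℂ)) = tsupport g := by
  unfold tsupport
  congr 1
  ext x
  simp

section Localized

variable {ι : Type*} {a b : ι → L2 d} (ha : Orthonormal ℂ a) (hb : Orthonormal ℂ b)
  {x y : ι → Space d} {ρ : ℝ}

/-- Only the finitely many balls that meet the support of `f` contribute, so the product has finite
rank. -/
theorem isCompactOperator_mulOp_mul_partialIsometry
    (hax : ∀ i, VanishesOff (a i) (Metric.ball (x i) ρ))
    (hx : ∀ C : ℝ, {i | ‖x i‖ ≤ C}.Finite) (f : C_c(Space d, ℂ)) :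
    IsCompactOperator (mulOp f * ha.partialIsometry hb : L2 d →L[ℂ] L2 d) := by
  obtain ⟨C, hC⟩ := f.hasCompactSupport.isBounded.subset_closedBall 0
  have hF : ∀ i ∉ (hx (C + ρ)).toFinset, mulOp f (a i) = 0 := by
    intro i hi
    refine (hax i).mulOp_eq_zero (Set.disjoint_left.2 fun z hz hzf => hi ?_)
    have h1 : ‖z‖ ≤ C := by simpa using hC hzf
    rw [Set.Finite.mem_toFinset, Set.mem_ofPred_eq]
    have h2 := norm_sub_norm_le (x i) z
    rw [Metric.mem_ball, dist_comm, dist_eq_norm] at hz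
    linarith
  have hsum : (mulOp f * ha.partialIsometry hb : L2 d →L[ℂ] L2 d) =
      ∑ i ∈ (hx (C + ρ)).toFinset, (innerSL ℂ (b i)).smulRight (mulOp f (a i)) := by
    ext1 v
    have h1 := (ha.hasSum_partialIsometry hb v).mapL (mulOp f)
    simp only [map_smul] at h1
    refine h1.unique ?_
    rw [sum_apply]
    exact hasSum_sum_of_ne_finset_zero fun i hi => by rw [hF i hi, smul_zero]
  rw [hsum]
  refine Finset.sum_induction _ (fun T : L2 d →L[ℂ] L2 d => IsCompactOperator T)
    (fun T S hT hS => hT.add hS) isCompactOperator_zero fun i _ => ?_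
  exact (isCompactOperator_of_locallyCompactSpace_rng
    (ContinuousLinearMap.toSpanSingleton ℂ (mulOp f (a i)))).comp_clm (innerSL ℂ (b i))

theorem isLocallyCompact_partialIsometry
    (hax : ∀ i, VanishesOff (a i) (Metric.ball (x i) ρ))
    (hby : ∀ i, VanishesOff (b i) (Metric.ball (y i) ρ))
    (hx : ∀ C : ℝ, {i | ‖x i‖ ≤ C}.Finite) (hy : ∀ C : ℝ, {i | ‖y i‖ ≤ C}.Finite) :
    IsLocallyCompact (ha.partialIsometry hb) := by
  -- The remaining side follows by adjoints: `T f = (f̄ T*)*`, and `T*` is the same operator with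
  -- the families exchanged.
  refine fun f => ⟨?_, isCompactOperator_mulOp_mul_partialIsometry ha hb hax hx f⟩
  have h := isCompactOperator_star
    (isCompactOperator_mulOp_mul_partialIsometry hb ha hby hy (star f))
  rwa [star_mul, star_mulOp, star_star, Orthonormal.star_partialIsometry] at h

/-- The sum is killed term by term: a nonzero term would need both supports to meet balls of radius
`ρ` with centres at most `C` apart, hence to contain points at distance below `2ρ + C`. -/
theorem hasPropagation_partialIsometry
    (hax : ∀ i, VanishesOff (a i) (Metric.ball (x i) ρ))
    (hby : ∀ i, VanishesOff (b i) (Metric.ball (y i) ρ))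
    {C : ℝ} (hxy : ∀ i, dist (x i) (y i) ≤ C) :
    HasPropagation (ha.partialIsometry hb) (2 * ρ + C) := by
  intro f g hfg
  ext1 v
  have h1 := (ha.hasSum_partialIsometry hb (mulOp g v)).mapL (mulOp f)
  simp only [map_smul] at h1
  refine h1.unique ?_
  have h2 : (fun i => inner ℂ (b i) (mulOp g v) • mulOp f (a i)) = fun _ => (0 : L2 d) := by
    funext i
    by_cases hf : Disjoint (Metric.ball (x i) ρ) (tsupport f)
    · rw [(hax i).mulOp_eq_zero hf, smul_zero]
    by_cases hg : Disjoint (Metric.ball (y i) ρ) (tsupport g)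
    · rw [inner_mulOp, (hby i).mulOp_eq_zero (by rwa [tsupport_star]), inner_zero_left, zero_smul]
    obtain ⟨z, hz, hzf⟩ := Set.not_disjoint_iff.1 hf
    obtain ⟨w, hw, hwg⟩ := Set.not_disjoint_iff.1 hg
    have h3 := lt_setDist_imp hfg hzf hwg
    rw [edist_dist] at h3
    have h4 := (ENNReal.ofReal_lt_ofReal_iff_of_nonneg
      ?_).1 h3
    · rw [Metric.mem_ball] at hz hw
      have h5 := dist_triangle4 z (x i) (y i) w
      rw [dist_comm (y i) w] at h5
      linarith [hxy i]
    -- The sign of `ρ` is not assumed; it comes from the ball around `x i` being nonempty.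
    · have h6 : 0 < ρ := dist_nonneg.trans_lt (Metric.mem_ball.1 hz)
      linarith [dist_nonneg.trans (hxy i)]
  rw [h2]
  exact hasSum_zero

theorem partialIsometry_mem_algebraicRoe (hρ : 0 < ρ)
    (hax : ∀ i, VanishesOff (a i) (Metric.ball (x i) ρ))
    (hby : ∀ i, VanishesOff (b i) (Metric.ball (y i) ρ))
    (hx : ∀ C : ℝ, {i | ‖x i‖ ≤ C}.Finite) (hy : ∀ C : ℝ, {i | ‖y i‖ ≤ C}.Finite)
    {C : ℝ} (hC : 0 ≤ C) (hxy : ∀ i, dist (x i) (y i) ≤ C) :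
    ha.partialIsometry hb ∈ algebraicRoe d :=
  ⟨isLocallyCompact_partialIsometry ha hb hax hby hx hy, 2 * ρ + C, by positivity,
    hasPropagation_partialIsometry ha hb hax hby hxy⟩

end Localized

theorem IsUniformlyDiscrete.finite {r : ℝ} {𝔇 : Set (Space d)} (h : IsUniformlyDiscrete r 𝔇)
    (C : ℝ) : {γ : 𝔇 | ‖(γ : Space d)‖ ≤ C}.Finite := by
  have htb : TotallyBounded (Metric.closedBall (0 : Space d) C) :=
    (isCompact_closedBall _ _).totallyBounded
  -- With radius `r / 2`, two points of `𝔇` in one covering ball are less than `r` apart, so the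
  -- first lies in both `r`-balls; each covering ball thus holds at most one point.
  obtain ⟨t, ht, hcov⟩ := Metric.totallyBounded_iff.1 htb (r / 2) (half_pos h.1)
  refine (ht.biUnion (t := fun z => {γ : 𝔇 | (γ : Space d) ∈ Metric.ball z (r / 2)})
    fun z _ => Set.Subsingleton.finite ?_).subset ?_
  · intro γ hγ γ' hγ'
    by_contra hne
    have h1 := h.2 γ.2 γ'.2 (fun h' => hne (Subtype.ext h'))
    refine Set.disjoint_left.1 h1 (Metric.mem_ball_self h.1) ?_
    rw [Metric.mem_ball]
    simp only [Set.mem_ofPred_eq, Metric.mem_ball] at hγ hγ'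
    have := dist_triangle_right (γ : Space d) γ' z
    linarith
  · intro γ hγ
    simpa using hcov (mem_closedBall_zero_iff.2 hγ)

theorem IsUniformlyDiscrete.countable {r : ℝ} {𝔇 : Set (Space d)}
    (h : IsUniformlyDiscrete r 𝔇) : Countable 𝔇 :=
  (h.2.countable_of_isOpen (fun _ _ => Metric.isOpen_ball)
    fun γ _ => ⟨γ, Metric.mem_ball_self h.1⟩).to_subtype

/-- Disjoint measurable sets of positive finite measure carry an orthonormal family. -/
theorem exists_orthonormal_of_disjoint {ι : Type*} (s : ι → Set (Space d))
    (hs : ∀ i, MeasurableSet (s i)) (hpos : ∀ i, volume (s i) ≠ 0)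
    (hfin : ∀ i, volume (s i) ≠ ∞) (hdis : Pairwise fun i j => Disjoint (s i) (s j)) :
    ∃ ψ : ι → L2 d, Orthonormal ℂ ψ ∧ ∀ i, VanishesOff (ψ i) (s i) := by
  let e : ι → L2 d := fun i => indicatorConstLp 2 (hs i) (hfin i) (1 : ℂ)
  have he : ∀ i, VanishesOff (e i) (s i) := fun i => indicatorConstLp_coeFn_notMem
  have hne : ∀ i, ‖e i‖ ≠ 0 := by
    intro i
    rw [norm_indicatorConstLp two_ne_zero ENNReal.ofNat_ne_top, norm_one, one_mul]
    exact (Real.rpow_pos_of_pos (ENNReal.toReal_pos (hpos i) (hfin i)) _).ne'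
  refine ⟨fun i => ((‖e i‖ : ℂ)⁻¹) • e i, ⟨fun i => ?_, fun i j hij => ?_⟩, fun i => ?_⟩
  · rw [norm_smul, norm_inv, Complex.norm_real, norm_norm, inv_mul_cancel₀ (hne i)]
  · beta_reduce
    rw [inner_smul_left, inner_smul_right]
    have : inner ℂ (e i) (e j) = 0 := by
      rw [L2.inner_def]
      refine integral_eq_zero_of_ae ?_
      filter_upwards [he i, he j] with y h1 h2
      by_cases hy : y ∈ s i
      · rw [h2 (Set.disjoint_left.1 (hdis hij) hy), inner_zero_right]
        rfl
      · rw [h1 hy, inner_zero_left]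
        rfl
    rw [this, mul_zero, mul_zero]
  · filter_upwards [he i, Lp.coeFn_smul ((‖e i‖ : ℂ)⁻¹) (e i)] with y h1 h2 hy
    rw [h2, Pi.smul_apply, h1 hy, smul_zero]

/-- For any countable family of points in `ℝ^d`, `d ≥ 1`, there is an orthonormal family of
functions localized in balls of a fixed radius around these points. -/
theorem exists_orthonormal_vanishesOff_ball (hd : 1 ≤ d) {ι : Type*} [Countable ι]
    (x : ι → Space d) :
    ∃ ψ : ι → L2 d, Orthonormal ℂ ψ ∧ ∀ i, VanishesOff (ψ i) (Metric.ball (x i) 7) := by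
  obtain ⟨n, hn⟩ := exists_injective_nat ι
  let o : Fin d := ⟨0, hd⟩
  -- The points `x i` may cluster or coincide, so the balls can overlap. Disjointness is instead
  -- forced by the sine of one coordinate, confined to disjoint subintervals of `(0, 1)`, one for
  -- each index.
  let I : ℕ → Set ℝ := fun k => Set.Ioo (1 / ((k : ℝ) + 2)) (1 / ((k : ℝ) + 1))
  have hI : ∀ k l : ℕ, k < l → Disjoint (I k) (I l) := by
    intro k l hkl
    refine Set.disjoint_left.2 fun t ht ht' => ?_
    have h1 : (k : ℝ) + 1 ≤ l := by exact_mod_cast hkl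
    have h2 : 1 / ((l : ℝ) + 1) ≤ 1 / ((k : ℝ) + 2) :=
      one_div_le_one_div_of_le (by positivity) (by linarith)
    exact absurd (ht.1.trans ht'.2) (not_lt.2 h2)
  let s : ι → Set (Space d) := fun i => Metric.ball (x i) 7 ∩ {z | Real.sin (z o) ∈ I (n i)}
  have hopen : ∀ i, IsOpen (s i) := fun i =>
    Metric.isOpen_ball.inter (isOpen_Ioo.preimage (by fun_prop))
  have hnonempty : ∀ i, (s i).Nonempty := by
    intro i
    obtain ⟨c, hc⟩ : (I (n i)).Nonempty := Set.nonempty_Ioo.2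
      (one_div_lt_one_div_of_lt (by positivity) (by linarith))
    have hc0 : 0 < c := lt_trans (by positivity) hc.1
    have hc1 : c ≤ 1 := hc.2.le.trans (by
      rw [div_le_one (by positivity)]
      linarith [(n i).cast_nonneg (α := ℝ)])
    -- Moving the coordinate by less than one period `2π < 7` attains any sine value in `(0, 1]`;
    -- this is the source of the radius 7.
    obtain ⟨t, ht, hct⟩ := Real.sin_periodic.exists_mem_Ico Real.two_pi_pos (Real.arcsin c) (x i o)
    rw [Real.sin_arcsin (by linarith) hc1] at hct
    refine ⟨x i + EuclideanSpace.single o (t - x i o), ?_, ?_⟩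
    · rw [Metric.mem_ball, dist_eq_norm, add_sub_cancel_left, PiLp.norm_single,
        Real.norm_eq_abs, abs_of_nonneg (by linarith [ht.1])]
      linarith [ht.2, Real.pi_lt_d2]
    · simpa [hct] using hc
  obtain ⟨ψ, hψ, hψs⟩ := exists_orthonormal_of_disjoint s (fun i => (hopen i).measurableSet)
    (fun i => ((hopen i).measure_pos volume (hnonempty i)).ne')
    (fun i => ((measure_mono Set.inter_subset_left).trans_lt measure_ball_lt_top).ne)
    (fun i j hij => by
      refine Disjoint.mono Set.inter_subset_right Set.inter_subset_right ?_
      rcases lt_or_gt_of_ne (hn.ne hij) with h | h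
      · exact (hI _ _ h).preimage fun z : Space d => Real.sin (z o)
      · exact ((hI _ _ h).symm).preimage fun z : Space d => Real.sin (z o))
  exact ⟨ψ, hψ, fun i => (hψs i).mono fun y h hy => h fun h' => hy h'.1⟩

end Roe

end

/-! ### Rays to infinity and the swindle in the Roe algebra -/

noncomputable section

open MeasureTheory Topology
open scoped ENNReal CompactlySupported

namespace Roe

variable {d : ℕ}

/-- A coordinate vector or its negative works; a unit vector exists because `d ≥ 1`. -/
theorem exists_unit_inner_nonneg (hd : 1 ≤ d) (z : Space d) :
    ∃ u : Space d, ‖u‖ = 1 ∧ 0 ≤ inner ℝ z u := by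
  let e : Space d := EuclideanSpace.single ⟨0, hd⟩ 1
  have he : ‖e‖ = 1 := by simp [e]
  rcases le_total 0 (inner ℝ z e) with h | h
  · exact ⟨e, he, h⟩
  · exact ⟨-e, by rwa [norm_neg], by rw [inner_neg_right]; linarith⟩

/-- Moving in a direction at an acute angle increases the norm. -/
theorem sq_norm_add_sq_le {z u : Space d} (hu : ‖u‖ = 1) (hzu : 0 ≤ inner ℝ z u) {t : ℝ}
    (ht : 0 ≤ t) : ‖z‖ ^ 2 + t ^ 2 ≤ ‖z + t • u‖ ^ 2 := by
  rw [norm_add_sq_real, inner_smul_right, norm_smul, hu, mul_one, Real.norm_eq_abs, sq_abs]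
  nlinarith [mul_nonneg ht hzu]

/-- The rays emanating from the points of a uniformly discrete set can be chosen such that their
integer points form a locally finite family. -/
theorem IsUniformlyDiscrete.exists_rays (hd : 1 ≤ d) {r : ℝ} {𝔇 : Set (Space d)}
    (h : IsUniformlyDiscrete r 𝔇) :
    ∃ u : 𝔇 → Space d, (∀ γ, ‖u γ‖ = 1) ∧
      ∀ C : ℝ, {i : 𝔇 × ℕ | ‖(i.1 : Space d) + (i.2 : ℝ) • u i.1‖ ≤ C}.Finite := by
  choose u hu hzu using fun γ : 𝔇 => exists_unit_inner_nonneg hd (γ : Space d)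
  -- From `‖γ‖² + n² ≤ C²` both `‖γ‖` and `n` are at most `C`, which leaves finitely many choices of
  -- each.
  refine ⟨u, hu, fun C => ((h.finite C).prod (Set.finite_Iic ⌊C⌋₊)).subset ?_⟩
  rintro ⟨γ, n⟩ hi
  have hC : ‖(γ : Space d) + (n : ℝ) • u γ‖ ≤ C := hi
  have h1 := sq_norm_add_sq_le (hu γ) (hzu γ) n.cast_nonneg
  have h0 : 0 ≤ C := (norm_nonneg _).trans hC
  have h2 := pow_le_pow_left₀ (norm_nonneg _) hC 2
  refine ⟨?_, Nat.le_floor ?_⟩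
  · exact abs_le_of_sq_le_sq' (by nlinarith [sq_nonneg (n : ℝ)]) h0 |>.2
  · exact abs_le_of_sq_le_sq' (by nlinarith [sq_nonneg ‖(γ : Space d)‖]) h0 |>.2

/-- The projection onto the span of a localized orthonormal family around a uniformly discrete set
has trivial class in the `K₀`-group of the Roe algebra. -/
theorem ofProj_partialIsometry_eq_zero (hd : 1 ≤ d) {r : ℝ} {𝔇 : Set (Space d)}
    (h : IsUniformlyDiscrete r 𝔇) {φ : 𝔇 → L2 d} (hφ : Orthonormal ℂ φ)
    (hloc : ∀ γ : 𝔇, VanishesOff (φ γ) (Metric.ball (γ : Space d) r))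
    (P : roeAlgebra d) (hP : IsStarProjection P)
    (hPφ : (P : L2 d →L[ℂ] L2 d) = hφ.partialIsometry hφ) : KTheory.K0.ofProj P hP = 0 := by
  have := h.countable
  obtain ⟨u, hu, hfin⟩ := h.exists_rays hd
  let x : 𝔇 × ℕ → Space d := fun i => (i.1 : Space d) + (i.2 : ℝ) • u i.1
  obtain ⟨ψ, hψ, hψx⟩ := exists_orthonormal_vanishesOff_ball hd x
  let ι₀ : 𝔇 → 𝔇 × ℕ := fun γ => (γ, 0)
  let σ : 𝔇 × ℕ → 𝔇 × ℕ := fun i => (i.1, i.2 + 1)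
  have hι₀ : ι₀.Injective := fun γ γ' h => congrArg Prod.fst h
  have hσ : σ.Injective := fun i j h =>
    Prod.ext (congrArg Prod.fst h :) (Nat.succ_injective (congrArg Prod.snd h))
  have hcompl : IsCompl (Set.range ι₀) (Set.range σ) := by
    refine isCompl_iff.2 ⟨Set.disjoint_left.2 ?_, codisjoint_iff.2 ?_⟩
    · rintro _ ⟨γ, rfl⟩ ⟨i, hi⟩
      exact Nat.succ_ne_zero _ (congrArg Prod.snd hi)
    · refine Set.eq_univ_of_forall ?_
      rintro ⟨γ, _ | n⟩
      · exact Or.inl ⟨γ, rfl⟩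
      · exact Or.inr ⟨(γ, n), rfl⟩
  have hψ₀ := hψ.comp ι₀ hι₀
  have hψσ := hψ.comp σ hσ
  -- A common radius for `φ`, localized at scale `r`, and `ψ`, localized at scale 7.
  have hρ : 0 < max r 7 := lt_max_of_lt_left h.1
  have hxfin : ∀ C : ℝ, {i | ‖x i‖ ≤ C}.Finite := hfin
  have hxσfin : ∀ C : ℝ, {i | ‖x (σ i)‖ ≤ C}.Finite := fun C =>
    (hxfin C).preimage hσ.injOn
  have hψx' : ∀ i, VanishesOff (ψ i) (Metric.ball (x i) (max r 7)) := fun i =>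
    (hψx i).mono fun y hy hy' => hy fun h' => hy' (Metric.ball_subset_ball (le_max_right _ _) h')
  have hψ₀x : ∀ γ, VanishesOff ((ψ ∘ ι₀) γ) (Metric.ball (γ : Space d) (max r 7)) := fun γ => by
    have h1 := hψx' (γ, 0)
    have h2 : x (γ, 0) = γ := by simp [x]
    rwa [h2] at h1
  have hφx : ∀ γ : 𝔇, VanishesOff (φ γ) (Metric.ball (γ : Space d) (max r 7)) := fun γ =>
    (hloc γ).mono fun y hy hy' => hy fun h' => hy' (Metric.ball_subset_ball (le_max_left _ _) h')
  have hvmem : hφ.partialIsometry hψ₀ ∈ algebraicRoe d :=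
    partialIsometry_mem_algebraicRoe hφ hψ₀ hρ hφx hψ₀x h.finite h.finite le_rfl
      fun γ => (dist_self _).le
  have hqmem : hψ₀.partialIsometry hψ₀ ∈ algebraicRoe d :=
    partialIsometry_mem_algebraicRoe hψ₀ hψ₀ hρ hψ₀x hψ₀x h.finite h.finite le_rfl
      fun γ => (dist_self _).le
  -- The shift moves each centre by the unit vector `u_γ`, so its centres have displacement 1 and
  -- its propagation is finite.
  have hsmem : hψσ.partialIsometry hψ ∈ algebraicRoe d := by
    refine partialIsometry_mem_algebraicRoe hψσ hψ hρ (fun i => hψx' (σ i)) hψx' hxσfin hxfin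
      zero_le_one fun i => ?_
    have h1 : x (σ i) - x i = u i.1 := by
      simp only [x, σ, Nat.cast_add, Nat.cast_one, add_smul, one_smul]
      abel
    rw [dist_eq_norm, h1, hu]
  have hle : algebraicRoe d ≤ roeAlgebra d := (algebraicRoe d).le_topologicalClosure
  let v : roeAlgebra d := ⟨_, hle hvmem⟩
  let q : roeAlgebra d := ⟨_, hle hqmem⟩
  let s : roeAlgebra d := ⟨_, hle hsmem⟩
  have hss : ((s * star s : roeAlgebra d) : L2 d →L[ℂ] L2 d) = hψσ.partialIsometry hψσ := by
    change hψσ.partialIsometry hψ * star (hψσ.partialIsometry hψ) = _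
    rw [Orthonormal.star_partialIsometry, Orthonormal.partialIsometry_mul]
  have hss' : ((star s * s : roeAlgebra d) : L2 d →L[ℂ] L2 d) = hψ.partialIsometry hψ := by
    change star (hψσ.partialIsometry hψ) * hψσ.partialIsometry hψ = _
    rw [Orthonormal.star_partialIsometry, Orthonormal.partialIsometry_mul]
  have hproj : ∀ {T : roeAlgebra d}, IsStarProjection (T : L2 d →L[ℂ] L2 d) →
      IsStarProjection T := fun hT =>
    ⟨Subtype.ext hT.isIdempotentElem, Subtype.ext hT.isSelfAdjoint⟩
  refine KTheory.K0.ofProj_eq_zero_of_swindle (q₀ := q) (s := s) (v := v) hP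
    (hproj hψ₀.isStarProjection_partialIsometry)
    (hproj (hss ▸ hψσ.isStarProjection_partialIsometry))
    (hproj (hss' ▸ hψ.isStarProjection_partialIsometry))
    (Subtype.ext ?_) (Subtype.ext ?_) (Subtype.ext ?_) (Subtype.ext ?_)
  · rw [hPφ]
    change _ = hφ.partialIsometry hψ₀ * star (hφ.partialIsometry hψ₀)
    rw [Orthonormal.star_partialIsometry, Orthonormal.partialIsometry_mul]
  · change hψ₀.partialIsometry hψ₀ = star (hφ.partialIsometry hψ₀) * hφ.partialIsometry hψ₀
    rw [Orthonormal.star_partialIsometry, Orthonormal.partialIsometry_mul]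
  · rw [hss']
    change _ = hψ₀.partialIsometry hψ₀ + ((s * star s : roeAlgebra d) : L2 d →L[ℂ] L2 d)
    rw [hss]
    exact hψ.partialIsometry_self_eq_add hι₀ hσ hcompl
  · change hψ₀.partialIsometry hψ₀ * ((s * star s : roeAlgebra d) : L2 d →L[ℂ] L2 d) = 0
    rw [hss]
    refine Orthonormal.partialIsometry_mul_eq_zero _ _ _ _ fun γ i => hψ.2 fun h' => ?_
    exact Nat.succ_ne_zero _ (congrArg Prod.snd h').symm

end Roe

end

/-! ### The main theorem -/

theorem mainTheorem3 {d : ℕ} (hd : 1 ≤ d) (H : ClosedSubmodule ℂ (Roe.L2 d)) (r : ℝ)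
    (𝔇 : Set (Roe.Space d)) (φ : 𝔇 → Roe.L2 d) (hφ : Roe.IsExtremelyLocalizedGWB H r 𝔇 φ) :
    (∀ ψ : Roe.L2 d, HasSum (fun γ => inner ℂ (φ γ) ψ • φ γ) (H.toSubmodule.starProjection ψ)) ∧
    Roe.IsLocallyCompact H.toSubmodule.starProjection ∧
    Roe.HasPropagation H.toSubmodule.starProjection (2 * r) ∧
    H.toSubmodule.starProjection ∈ Roe.algebraicRoe d ∧
    ∃ (P : Roe.roeAlgebra d) (hP : IsStarProjection P),
      (P : Roe.L2 d →L[ℂ] Roe.L2 d) = H.toSubmodule.starProjection ∧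
      KTheory.K0.ofProj P hP = 0 := by
  have hloc := fun γ => Roe.vanishesOff_of_essSupport_subset (hφ.essSupport_subset γ)
  have hφo := hφ.orthonormal
  have hfin := hφ.isUniformlyDiscrete.finite
  have hr := hφ.isUniformlyDiscrete.1
  -- Both families are `φ` with the same centres, so the displacement is 0 and the bound is exactly
  -- `2r`.
  have hprop := Roe.hasPropagation_partialIsometry hφo hφo hloc hloc (C := 0)
    fun γ => (dist_self _).le
  rw [add_zero] at hprop
  have hlc := Roe.isLocallyCompact_partialIsometry hφo hφo hloc hloc hfin hfin
  have hmem : hφo.partialIsometry hφo ∈ Roe.algebraicRoe d :=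
    ⟨hlc, 2 * r, by positivity, hprop⟩
  have hPH := hφo.partialIsometry_self_eq_starProjection H.toSubmodule hφ.closure_span
  rw [← hPH]
  refine ⟨hφo.hasSum_partialIsometry hφo, hlc, hprop, hmem,
    ⟨_, (Roe.algebraicRoe d).le_topologicalClosure hmem⟩,
    ⟨Subtype.ext (hφo.partialIsometry_mul hφo hφo), Subtype.ext (hφo.star_partialIsometry hφo)⟩,
    rfl, ?_⟩
  exact Roe.ofProj_partialIsometry_eq_zero hd hφ.isUniformlyDiscrete hφo hloc _ _ rfl
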